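/- Let $\Omega\subseteq\mathbb C^m$ be a bounded domain and let $\mathcal A=\mathcal A(\Omega)$ be the closure, in the supremum norm on $\Omega$, of the functions holomorphic in some neighbourhood of $\overline\Omega$. A \emph{Hilbert module} over $\mathcal A$ is a complex Hilbert space $\mathcal M$ with a unital $\mathcal A$-module structure, compatible with the complex scalars, for which the multiplication $\mathcal A\times\mathcal M\to\mathcal M$ is continuous; $M_\varphi$ denotes multiplication by $\varphi$. A \emph{submodule} is a closed subspace invariant under $\mathcal A$, with the restricted structure. For Hilbert modules $\mathcal M,\mathcal N$, the module tensor product $\mathcal M\otimes_{\mathcal A}\mathcal N$ is the quotient of the Hilbert space tensor product $\mathcal M\otimes\mathcal N$ by the closed linear span of the vectors $\varphi f\otimes g-f\otimes\varphi g$ ($\varphi\in\mathcal A$, $f\in\mathcal M$, $g\in\mathcal N$), and $f\otimes_{\mathcal A}g$ is the class of $f\otimes g$. For $z\in\Omega$, $\mathbb C_z$ is the Hilbert module $\mathbb C$ with $\varphi v=\varphi(z)v$, and $1_z$ is its element $1$. A Hilbert module $\mathcal R$ is \emph{quasi-free} relative to a nonempty family $(f_i)_{i\in I}$ that generates it (the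 $\mathcal A$-linear span of the $f_i$ is dense in $\mathcal R$), of rank the cardinality of $I$, if (i) for each $z\in\Omega$ the vectors $f_i\otimes_{\mathcal A}1_z$ are linearly independent and have dense linear span in $\mathcal R\otimes_{\mathcal A}\mathbb C_z$; (ii) the linear maps $X_z$ from the linear span of the $f_i\otimes_{\mathcal A}1_z$ to $\ell^2(I)$ given by $X_z(f_i\otimes_{\mathcal A}1_z)=e_i$ are bounded in norm, locally uniformly in $z\in\Omega$; and (iii) for $f\in\mathcal R$, $f\otimes_{\mathcal A}1_z=0$ for all $z\in\Omega$ if and only if $f=0$. A Hilbert module $\mathcal M$ belongs to - class $C_{\cdot0}$ if $M_{\varphi_n}^*\to0$ in the strong operator topology for every sequence $(\varphi_n)$ in the unit ball of $\mathcal A$ with $\varphi_n(z)\to0$ for each $z\in\Omega$; - class (PS) if $\mathcal M$ is the closed linear span of the vectors $h$ for which there are $z\in\Omega$ and an integer $n\ge1$ with $(M_\varphi-\varphi(z)I)^{*n}h=0$ for all $\varphi\in\mathcal A$; - class (SM) if there is a Hilbert module $\mathcal R$ that is quasi-free of rank one relative to a vector $g$ such that the map $\mathcal M\to\mathcal M\otimes_{\mathcal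 A}\mathcal R$, $f\mapsto f\otimes_{\mathcal A}g$, is one-to-one. **Theorem.** Let $\mathcal M$ be a Hilbert module over $\mathcal A(\Omega)$ and $\mathcal M_0$ a submodule of $\mathcal M$. 1. If $\mathcal M$ is in class $C_{\cdot0}$, then so is $\mathcal M_0$; if $\mathcal M$ is in class (PS), then so is $\mathcal M_0$; if $\mathcal M$ is in class (SM), then so is $\mathcal M_0$. 2. If $\mathcal M$ is quasi-free (relative to some generating family, of any rank $\ge1$), then $\mathcal M_0$ belongs to all three classes $C_{\cdot0}$, (PS) and (SM). -/

import Mathlib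

open Filter Topology TensorProduct
open scoped BoundedContinuousFunction

noncomputable section

/-- The bounded continuous functions on `Ω ⊆ ℂᵐ` that are restrictions of functions holomorphic on
some open neighbourhood of the closure of `Ω`. -/
def holoNhds {m : ℕ} (Ω : Set (Fin m → ℂ)) : Subalgebra ℂ (Ω →ᵇ ℂ) where
  carrier := {f | ∃ U : Set (Fin m → ℂ), IsOpen U ∧ closure Ω ⊆ U ∧
    ∃ F : (Fin m → ℂ) → ℂ, DifferentiableOn ℂ F U ∧ ∀ x : Ω, f x = F x}
  mul_mem' := by
    rintro f g ⟨U, hU, hΩU, F, hF, hfF⟩ ⟨V, hV, hΩV, G, hG, hgG⟩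
    refine ⟨U ∩ V, hU.inter hV, Set.subset_inter hΩU hΩV, fun z => F z * G z, ?_, ?_⟩
    · exact (hF.mono Set.inter_subset_left).mul (hG.mono Set.inter_subset_right)
    · intro x
      simp [hfF, hgG]
  add_mem' := by
    rintro f g ⟨U, hU, hΩU, F, hF, hfF⟩ ⟨V, hV, hΩV, G, hG, hgG⟩
    refine ⟨U ∩ V, hU.inter hV, Set.subset_inter hΩU hΩV, fun z => F z + G z, ?_, ?_⟩
    · exact (hF.mono Set.inter_subset_left).add (hG.mono Set.inter_subset_right)
    · intro x
      simp [hfF, hgG]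
  algebraMap_mem' := by
    intro c
    exact ⟨Set.univ, isOpen_univ, Set.subset_univ _, fun _ => c, differentiableOn_const c,
      fun _ => rfl⟩

/-- The function algebra `𝒜(Ω)`: the closure, in the supremum norm on `Ω`, of the functions
holomorphic in a neighbourhood of the closure of `Ω`. -/
def FunAlg {m : ℕ} (Ω : Set (Fin m → ℂ)) : Type := (holoNhds Ω).topologicalClosure

namespace FunAlg

variable {m : ℕ} {Ω : Set (Fin m → ℂ)}

instance : NormedCommRing (FunAlg Ω) :=
  inferInstanceAs (NormedCommRing (holoNhds Ω).topologicalClosure)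

instance : NormedAlgebra ℂ (FunAlg Ω) :=
  inferInstanceAs (NormedAlgebra ℂ (holoNhds Ω).topologicalClosure)

/-- An element of `𝒜(Ω)` as a bounded continuous function on `Ω`. -/
def toBCF (φ : FunAlg Ω) : Ω →ᵇ ℂ := Subtype.val φ

instance : CoeFun (FunAlg Ω) fun _ => Ω → ℂ := ⟨fun φ => toBCF φ⟩

theorem norm_def (φ : FunAlg Ω) : ‖φ‖ = ‖toBCF φ‖ := rfl

/-- Evaluation of the elements of `𝒜(Ω)` at a point of `Ω`. -/
def evalAt (z : Ω) : FunAlg Ω →ₐ[ℂ] ℂ where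
  toFun φ := φ z
  map_one' := rfl
  map_mul' _ _ := rfl
  map_zero' := rfl
  map_add' _ _ := rfl
  commutes' _ := rfl

end FunAlg

/- A Hilbert module over `𝒜(Ω)` is a complex Hilbert space `M` with a unital `𝒜(Ω)`-module structure
that extends the scalar multiplication by `ℂ` (`IsScalarTower ℂ (FunAlg Ω) M`) and for which the
multiplication `𝒜(Ω) × M → M` is continuous (`ContinuousSMul (FunAlg Ω) M`). -/

/-- The operator `M_φ` of module multiplication by `φ`. -/
def mulOp {m : ℕ} {Ω : Set (Fin m → ℂ)} (M : Type*) [NormedAddCommGroup M]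
    [InnerProductSpace ℂ M] [Module (FunAlg Ω) M] [IsScalarTower ℂ (FunAlg Ω) M]
    [ContinuousSMul (FunAlg Ω) M] (φ : FunAlg Ω) : M →L[ℂ] M where
  toFun f := φ • f
  map_add' := smul_add φ
  map_smul' c f := smul_comm φ c f
  cont := continuous_const_smul φ

/-- A submodule of a Hilbert module carries the restricted inner product. -/
instance submoduleInnerProductSpace {m : ℕ} {Ω : Set (Fin m → ℂ)} {M : Type*}
    [NormedAddCommGroup M] [InnerProductSpace ℂ M] [Module (FunAlg Ω) M]
    [IsScalarTower ℂ (FunAlg Ω) M] (M₀ : Submodule (FunAlg Ω) M) : InnerProductSpace ℂ M₀ where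
  toNormedSpace := Submodule.normedSpace M₀
  inner x y := inner ℂ (x : M) (y : M)
  norm_sq_eq_re_inner x := norm_sq_eq_re_inner (𝕜 := ℂ) (x : M)
  conj_inner_symm x y := inner_conj_symm (x : M) (y : M)
  add_left x y z := inner_add_left (x : M) (y : M) (z : M)
  smul_left x y r := inner_smul_left (x : M) (y : M) r

/-- The underlying Hilbert space of the one-dimensional Hilbert module `ℂ_z`. -/
def PointModule {m : ℕ} {Ω : Set (Fin m → ℂ)} (_z : Ω) : Type := ℂ

namespace PointModule

variable {m : ℕ} {Ω : Set (Fin m → ℂ)} (z : Ω)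

instance : NormedAddCommGroup (PointModule z) := inferInstanceAs (NormedAddCommGroup ℂ)

instance : InnerProductSpace ℂ (PointModule z) := inferInstanceAs (InnerProductSpace ℂ ℂ)

instance : CompleteSpace (PointModule z) := inferInstanceAs (CompleteSpace ℂ)

/-- `φ v = φ(z) v` for `φ ∈ 𝒜(Ω)` and `v ∈ ℂ_z`. -/
instance : Module (FunAlg Ω) (PointModule z) :=
  Module.compHom (PointModule z) (FunAlg.evalAt z).toRingHom

theorem smul_def (φ : FunAlg Ω) (v : PointModule z) : φ • v = φ z • v := rfl

instance : IsScalarTower ℂ (FunAlg Ω) (PointModule z) where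
  smul_assoc c φ v := by
    rw [smul_def, smul_def, ← smul_assoc]
    rfl

instance : ContinuousSMul (FunAlg Ω) (PointModule z) where
  continuous_smul := by
    have h : Continuous fun p : FunAlg Ω × PointModule z => (p.1 z) • p.2 :=
      (((continuous_eval_const (F := Ω →ᵇ ℂ) z).comp
        continuous_subtype_val).comp continuous_fst).smul continuous_snd
    exact h

/-- The generator `1_z` of `ℂ_z`. -/
def one : PointModule z := (1 : ℂ)

end PointModule

section ModuleTensor

variable {m : ℕ} (Ω : Set (Fin m → ℂ)) (M N : Type*)
  [NormedAddCommGroup M] [InnerProductSpace ℂ M] [Module (FunAlg Ω) M]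
  [NormedAddCommGroup N] [InnerProductSpace ℂ N] [Module (FunAlg Ω) N]

/-- The closed subspace `𝒮` of the Hilbert space tensor product `M ⊗ N` (the completion of the
algebraic one) spanned by the vectors `φ f ⊗ g - f ⊗ φ g`. The set of these vectors is invariant
under multiplication by `𝒜(Ω)` in either factor, so this is also the closed submodule generated. -/
def balancing : Submodule ℂ (UniformSpace.Completion (M ⊗[ℂ] N)) :=
  (Submodule.span ℂ {t | ∃ (φ : FunAlg Ω) (f : M) (g : N),
    t = (((φ • f) ⊗ₜ[ℂ] g - f ⊗ₜ[ℂ] (φ • g) : M ⊗[ℂ] N) :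
      UniformSpace.Completion (M ⊗[ℂ] N))}).topologicalClosure

/-- The module tensor product of `M` and `N` over `𝒜(Ω)`: the quotient `(M ⊗ N) / 𝒮` with the
quotient norm. -/
abbrev ModuleTensor : Type _ := UniformSpace.Completion (M ⊗[ℂ] N) ⧸ balancing Ω M N

variable {M N}

/-- The elementary tensor of `f` and `g` in the module tensor product. -/
def mtmul (f : M) (g : N) : ModuleTensor Ω M N :=
  (balancing Ω M N).mkQ ((f ⊗ₜ[ℂ] g : M ⊗[ℂ] N) : UniformSpace.Completion (M ⊗[ℂ] N))

end ModuleTensor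

section Classes

variable {m : ℕ} {Ω : Set (Fin m → ℂ)}

/-- The element `f ⊗ 1_z` of the fiber `Sp_z(R)`, the module tensor product of `R` and `ℂ_z`. -/
def localize {R : Type*} [NormedAddCommGroup R] [InnerProductSpace ℂ R] [Module (FunAlg Ω) R]
    (z : Ω) (f : R) : ModuleTensor Ω R (PointModule z) :=
  mtmul Ω f (PointModule.one z)

/-- The map `X_z`, defined on the linear span of the vectors `f_i ⊗ 1_z` in the fiber `Sp_z(R)`, with
values in `ℓ²(ι)`: the linear map that sends `f_i ⊗ 1_z` to the standard basis vector `e_i`. -/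
def frameMap {R : Type*} [NormedAddCommGroup R] [InnerProductSpace ℂ R] [Module (FunAlg Ω) R]
    {ι : Type*} (f : ι → R) (z : Ω) (h : LinearIndependent ℂ fun i => localize z (f i)) :
    Submodule.span ℂ (Set.range fun i => localize z (f i)) →ₗ[ℂ] lp (fun _ : ι => ℂ) 2 :=
  open Classical in
  Finsupp.linearCombination ℂ (fun i => lp.single 2 i (1 : ℂ)) ∘ₗ h.repr

/-- The Hilbert module `R` is quasi-free relative to the generating set `f_i`, `i ∈ ι`; its rank is
the cardinality of `ι`. -/
structure IsQuasiFree {R : Type*} [NormedAddCommGroup R] [InnerProductSpace ℂ R]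
    [Module (FunAlg Ω) R] {ι : Type*} (f : ι → R) : Prop where
  nonempty : Nonempty ι
  /-- the `f_i` generate `R` as a Hilbert module -/
  generates : Dense (Submodule.span (FunAlg Ω) (Set.range f) : Set R)
  linearIndependent : ∀ z : Ω, LinearIndependent ℂ fun i => localize z (f i)
  spans : ∀ z : Ω, Dense (Submodule.span ℂ (Set.range fun i => localize z (f i)) :
    Set (ModuleTensor Ω R (PointModule z)))
  /-- the norm of `X_z` is locally uniformly bounded -/
  locallyBounded : ∀ z₀ : Ω, ∃ C : ℝ, ∀ᶠ z in 𝓝 z₀, ∀ v,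
    ‖frameMap f z (linearIndependent z) v‖ ≤ C * ‖v‖
  separates : ∀ g : R, (∀ z : Ω, localize z g = 0) ↔ g = 0

variable (Ω)
variable (M : Type*) [NormedAddCommGroup M] [InnerProductSpace ℂ M] [CompleteSpace M]
  [Module (FunAlg Ω) M] [IsScalarTower ℂ (FunAlg Ω) M] [ContinuousSMul (FunAlg Ω) M]

/-- Class `C_{·0}`: `M_{φ_n}^* → 0` strongly for every sequence `φ_n` in the unit ball of `𝒜(Ω)` that
tends to `0` pointwise on `Ω`. -/
def ClassC0 : Prop :=
  ∀ φ : ℕ → FunAlg Ω, (∀ n, ‖φ n‖ ≤ 1) →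
    (∀ z : Ω, Tendsto (fun n => φ n z) atTop (𝓝 0)) →
    ∀ f : M, Tendsto (fun n => ContinuousLinearMap.adjoint (mulOp M (φ n)) f) atTop (𝓝 0)

variable {M} in
/-- `h` is a common generalized eigenvector for the adjoint of module multiplication: for some point
`z ∈ Ω` and some `n ≥ 1`, `h` lies in the kernel of `(M_φ - φ(z) I)^{*n}` for all `φ`. -/
def IsGenEigenvector (h : M) : Prop :=
  ∃ (z : Ω) (n : ℕ), 1 ≤ n ∧ ∀ φ : FunAlg Ω,
    (ContinuousLinearMap.adjoint
      (mulOp M φ - φ z • ContinuousLinearMap.id ℂ M) ^ n) h = 0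

/-- Class (PS): the common generalized eigenvectors for the adjoint of module multiplication span
`M` as a Hilbert space. -/
def ClassPS : Prop :=
  Dense (Submodule.span ℂ {h : M | IsGenEigenvector Ω h} : Set M)

/-- `M` is smooth relative to `R` and `g`: the map `f ↦ f ⊗ g` into the module tensor product of `M`
and `R` is one-to-one. -/
def IsSmooth {R : Type*} [NormedAddCommGroup R] [InnerProductSpace ℂ R] [Module (FunAlg Ω) R]
    (g : R) : Prop :=
  Function.Injective fun f : M => mtmul Ω f g

/-- Class (SM): `M` is smooth relative to some quasi-free Hilbert module `R` of rank one and
generating vector `g`. As `𝒜(Ω)` is separable for bounded `Ω`, so is every `R` of rank one, and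
`R : Type` is no restriction. -/
def ClassSM : Prop :=
  ∃ (R : Type) (_ : NormedAddCommGroup R) (_ : InnerProductSpace ℂ R) (_ : CompleteSpace R)
    (_ : Module (FunAlg Ω) R) (_ : IsScalarTower ℂ (FunAlg Ω) R)
    (_ : ContinuousSMul (FunAlg Ω) R) (g : R),
    IsQuasiFree (Ω := Ω) (fun _ : Unit => g) ∧ IsSmooth Ω M g

end Classes

end

/-! Everything rests on the common eigenvectors `h` of the adjoints `M_φ^*` at points of `Ω`. The
orthogonal complement of the vectors `φ f - φ(z) f` consists of the eigenvectors at `z`, so an `f`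
orthogonal to all of them has zero localization at `z` (`localize_eq_zero_of_forall_eigenvector`).
Condition (iii) of quasi-freeness thus makes the eigenvectors over all `z` span a dense subspace
(`dense_span_eigenvectors`), and this density yields all three classes.

`M_φ^*` acts on `h` as the conjugate of `φ(z)`, which gives `C_{·0}` and (PS). For (SM), if `h` and
`k` are eigenvectors at the same `z`, pairing with `h ⊗ k` descends to the module tensor product.
Hence `f ⊗ g = 0` forces `⟨h, f⟩⟨k, g⟩ = 0`, and `f = 0` once `g` pairs nontrivially with some `k`
at each `z`. Such a `g` is the constant 1 in the closure of `𝒜(Ω)` in `L²(Ω)`, where averages over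
polydiscs supply the `k`.

Passage to `M₀` compresses adjoints by the orthogonal projection, for the first two classes, and
uses functoriality of the tensor product for (SM). -/

noncomputable section

/-! ### Common eigenvectors and module tensor products -/

section Eigenvectors

variable {m : ℕ} {Ω : Set (Fin m → ℂ)} {M N : Type*}
  [NormedAddCommGroup M] [InnerProductSpace ℂ M] [Module (FunAlg Ω) M]
  [NormedAddCommGroup N] [InnerProductSpace ℂ N] [Module (FunAlg Ω) N]

/-- `h` is a common eigenvector at `z` of the adjoints of module multiplication. -/
def IsEigenvectorAt (z : Ω) (h : M) : Prop :=
  ∀ (φ : FunAlg Ω) (f : M), inner ℂ h (φ • f) = φ z * inner ℂ h f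

theorem isEigenvectorAt_one (z : Ω) : IsEigenvectorAt z (PointModule.one z) := by
  intro φ f
  rw [PointModule.smul_def, inner_smul_right]

/-- In either slot `φ` comes out of the pairing as the same scalar `φ(z)`; continuity handles the
closure. -/
theorem inner_eq_zero_of_mem_balancing {z : Ω} {h : M} {k : N} (hh : IsEigenvectorAt z h)
    (hk : IsEigenvectorAt z k) {t : UniformSpace.Completion (M ⊗[ℂ] N)}
    (ht : t ∈ balancing Ω M N) :
    inner ℂ ((h ⊗ₜ[ℂ] k : M ⊗[ℂ] N) : UniformSpace.Completion (M ⊗[ℂ] N)) t = 0 := by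
  set v := ((h ⊗ₜ[ℂ] k : M ⊗[ℂ] N) : UniformSpace.Completion (M ⊗[ℂ] N))
  suffices H : balancing Ω M N ≤ (innerSL ℂ v).ker from H ht
  refine Submodule.topologicalClosure_minimal _ ?_ (innerSL ℂ v).isClosed_ker
  rw [Submodule.span_le]
  rintro _ ⟨φ, f, g, rfl⟩
  change inner ℂ v _ = 0
  rw [UniformSpace.Completion.inner_coe, inner_sub_right, TensorProduct.inner_tmul,
    TensorProduct.inner_tmul, hh, hk]
  ring

theorem mtmul_eq_zero_iff {f : M} {g : N} : mtmul Ω f g = 0 ↔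
    ((f ⊗ₜ[ℂ] g : M ⊗[ℂ] N) : UniformSpace.Completion (M ⊗[ℂ] N)) ∈ balancing Ω M N := by
  rw [mtmul, Submodule.mkQ_apply, Submodule.Quotient.mk_eq_zero]

theorem inner_mul_inner_eq_zero {z : Ω} {h : M} {k : N} (hh : IsEigenvectorAt z h)
    (hk : IsEigenvectorAt z k) {f : M} {g : N} (hfg : mtmul Ω f g = 0) :
    inner ℂ h f * inner ℂ k g = 0 := by
  have := inner_eq_zero_of_mem_balancing hh hk (mtmul_eq_zero_iff.1 hfg)
  rwa [UniformSpace.Completion.inner_coe, TensorProduct.inner_tmul] at this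

/-- All representatives of a class pair equally with `h ⊗ k`, so Cauchy–Schwarz applies to one of
nearly minimal norm. With `N = ℂ_z` this bounds the norm of `f ⊗ 1_z` from below, which is what
controls `X_z`. -/
theorem norm_inner_le_mul_norm_mtmul {z : Ω} {h : M} {k : N} (hh : IsEigenvectorAt z h)
    (hk : IsEigenvectorAt z k) (f : M) (g : N) :
    ‖inner ℂ h f * inner ℂ k g‖ ≤ ‖h‖ * ‖k‖ * ‖mtmul Ω f g‖ := by
  refine le_of_forall_pos_le_add fun ε hε => ?_
  set C := ‖h‖ * ‖k‖ with hC
  have hC0 : 0 ≤ C := by positivity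
  -- Dividing by `C + 1` rather than `C` allows `C = 0`.
  obtain ⟨t, ht, htn⟩ := Submodule.Quotient.norm_mk_lt (mtmul Ω f g)
    (ε := ε / (C + 1)) (by positivity)
  have hmem := (Submodule.Quotient.eq (balancing Ω M N)).1 ht
  have h0 := inner_eq_zero_of_mem_balancing hh hk hmem
  rw [inner_sub_right, sub_eq_zero, UniformSpace.Completion.inner_coe,
    TensorProduct.inner_tmul] at h0
  rw [← h0]
  refine (norm_inner_le_norm _ _).trans ?_
  rw [UniformSpace.Completion.norm_coe, TensorProduct.norm_tmul, ← hC]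
  refine (mul_le_mul_of_nonneg_left htn.le hC0).trans ?_
  rw [mul_add]
  gcongr
  rw [← mul_div_assoc, div_le_iff₀ (by positivity)]
  nlinarith

/-- Localization at `z` as a continuous linear map. -/
def localizeL (z : Ω) : M →L[ℂ] ModuleTensor Ω M (PointModule z) :=
  (balancing Ω M (PointModule z)).mkQL ∘L
    (UniformSpace.Completion.toComplL (𝕜 := ℂ) (E := M ⊗[ℂ] PointModule z)) ∘L
    ((TensorProduct.mkL ℂ M (PointModule z)).flip (PointModule.one z))

theorem localizeL_apply (z : Ω) (f : M) : localizeL z f = localize z f := rfl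

theorem localize_smul (z : Ω) (φ : FunAlg Ω) (f : M) :
    localize z (φ • f) = φ z • localize z f := by
  rw [← localizeL_apply z f, ← map_smul, ← sub_eq_zero, ← localizeL_apply, ← map_sub,
    localizeL_apply, localize, mtmul_eq_zero_iff]
  refine Submodule.le_topologicalClosure _ (Submodule.subset_span ⟨φ, f, PointModule.one z, ?_⟩)
  rw [PointModule.smul_def, TensorProduct.sub_tmul, TensorProduct.smul_tmul (φ z)]

/-- Since `ℂ_z` is one-dimensional, every algebraic tensor has the form `f ⊗ 1_z`. -/
theorem denseRange_localize (z : Ω) : DenseRange (localize z : M → _) := by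
  have hT : DenseRange ((UniformSpace.Completion.toComplL (𝕜 := ℂ)
      (E := M ⊗[ℂ] PointModule z))) := UniformSpace.Completion.denseRange_coe
  have hQ : DenseRange (balancing Ω M (PointModule z)).mkQL :=
    (Submodule.mkQ_surjective _).denseRange
  have hsurj : Function.Surjective
      ((TensorProduct.mkL ℂ M (PointModule z)).flip (PointModule.one z)) := by
    intro t
    induction t with
    | zero => exact ⟨0, map_zero _⟩
    | add x y hx hy =>
      obtain ⟨a, rfl⟩ := hx
      obtain ⟨b, rfl⟩ := hy
      exact ⟨a + b, map_add _ _ _⟩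
    | tmul f v =>
      refine ⟨(show ℂ from v) • f, ?_⟩
      change ((show ℂ from v) • f) ⊗ₜ[ℂ] PointModule.one z = f ⊗ₜ[ℂ] v
      rw [TensorProduct.smul_tmul]
      congr 1
      exact mul_one (show ℂ from v)
  exact hQ.comp (hT.comp hsurj.denseRange (ContinuousLinearMap.continuous _))
    (ContinuousLinearMap.continuous _)

theorem localize_eq_zero_of_forall_eigenvector [CompleteSpace M] {z : Ω} {f : M}
    (hf : ∀ h : M, IsEigenvectorAt z h → inner ℂ h f = 0) : localize z f = 0 := by
  have : IsClosed (balancing Ω M (PointModule z) :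
      Set (UniformSpace.Completion (M ⊗[ℂ] PointModule z))) :=
    Submodule.isClosed_topologicalClosure _
  -- The quotient by a closed subspace is Hausdorff, so the kernel of `localizeL z` is closed.
  have : T3Space (ModuleTensor Ω M (PointModule z)) := Submodule.t3_quotient_of_isClosed _
  set K : Submodule ℂ M := Submodule.span ℂ {x | ∃ (φ : FunAlg Ω) (g : M), x = φ • g - φ z • g}
  have hK : K.topologicalClosure ≤ (localizeL z : M →L[ℂ] _).ker := by
    refine Submodule.topologicalClosure_minimal _ ?_ (localizeL z).isClosed_ker
    rw [Submodule.span_le]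
    rintro _ ⟨φ, g, rfl⟩
    change localizeL z _ = 0
    rw [map_sub, map_smul (localizeL z) (φ z), localizeL_apply, localizeL_apply, localize_smul,
      sub_self]
  suffices H : f ∈ K.topologicalClosure from hK H
  rw [← Submodule.orthogonal_orthogonal_eq_closure, Submodule.mem_orthogonal]
  intro h hh
  refine hf h fun φ g => ?_
  have := (Submodule.mem_orthogonal' _ _).1 hh _ (Submodule.subset_span ⟨φ, g, rfl⟩)
  rwa [inner_sub_right, inner_smul_right, sub_eq_zero] at this

theorem dense_span_eigenvectors [CompleteSpace M]
    (hsep : ∀ f : M, (∀ z : Ω, localize z f = 0) → f = 0) :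
    Dense (Submodule.span ℂ {h : M | ∃ z : Ω, IsEigenvectorAt z h} : Set M) := by
  rw [Submodule.dense_iff_topologicalClosure_eq_top, Submodule.topologicalClosure_eq_top_iff,
    Submodule.eq_bot_iff]
  intro f hf
  refine hsep f fun z => localize_eq_zero_of_forall_eigenvector fun h hh => ?_
  exact (Submodule.mem_orthogonal _ _).1 hf _ (Submodule.subset_span ⟨z, hh⟩)

theorem isSmooth_of_dense_span_eigenvectors [CompleteSpace M]
    (hM : Dense (Submodule.span ℂ {h : M | ∃ z : Ω, IsEigenvectorAt z h} : Set M)) {g : N}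
    (hg : ∀ z : Ω, ∃ k : N, IsEigenvectorAt z k ∧ inner ℂ k g ≠ 0) : IsSmooth Ω M g := by
  intro f₁ f₂ h12
  have h0 : mtmul Ω (f₁ - f₂) g = 0 := by
    have : mtmul Ω (f₁ - f₂) g = mtmul Ω f₁ g - mtmul Ω f₂ g := by
      simp only [mtmul, TensorProduct.sub_tmul, UniformSpace.Completion.coe_sub, map_sub]
    rw [this, sub_eq_zero]
    exact h12
  rw [← sub_eq_zero]
  rw [Submodule.dense_iff_topologicalClosure_eq_top, Submodule.topologicalClosure_eq_top_iff] at hM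
  rw [← Submodule.mem_bot ℂ, ← hM, Submodule.mem_orthogonal]
  intro h hh
  induction hh using Submodule.span_induction with
  | mem h hh =>
    obtain ⟨z, hz⟩ := hh
    obtain ⟨k, hk, hkg⟩ := hg z
    exact (mul_eq_zero.1 (inner_mul_inner_eq_zero hz hk h0)).resolve_right hkg
  | zero => exact inner_zero_left _
  | add x y _ _ hx hy => rw [inner_add_left, hx, hy, add_zero]
  | smul c x _ hx => rw [inner_smul_left, hx, mul_zero]

/-- A Hilbert module generated by one vector, with locally bounded reproducing kernels that
separate its elements, is quasi-free of rank one. -/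
theorem isQuasiFree_of_kernels {g : N} (hgen : Dense (Submodule.span (FunAlg Ω) {g} : Set N))
    (hker : ∀ z₀ : Ω, ∃ C : ℝ, ∀ᶠ z in 𝓝 z₀, ∃ k : N, IsEigenvectorAt z k ∧ inner ℂ k g = 1 ∧
      ‖k‖ ≤ C)
    (hsep : ∀ f : N, (∀ (z : Ω) (k : N), IsEigenvectorAt z k → inner ℂ k f = 0) → f = 0) :
    IsQuasiFree (Ω := Ω) (fun _ : Unit => g) := by
  have hone : ∀ z : Ω, inner ℂ (PointModule.one z) (PointModule.one z) = (1 : ℂ) := fun z => by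
    change inner ℂ (1 : ℂ) (1 : ℂ) = 1
    simp
  have hone' : ∀ z : Ω, ‖PointModule.one z‖ = 1 := fun z => by
    change ‖(1 : ℂ)‖ = 1
    simp
  -- This bound gives both linear independence (`g ⊗ 1_z ≠ 0`) and the local bound on `X_z`, whose
  -- norm is the inverse of that of `g ⊗ 1_z`.
  have hbound : ∀ (z : Ω) (k : N), IsEigenvectorAt z k → inner ℂ k g = 1 →
      1 ≤ ‖k‖ * ‖localize z g‖ := fun z k hk hkg => by
    have := norm_inner_le_mul_norm_mtmul hk (isEigenvectorAt_one z) g (PointModule.one z)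
    rw [hone, hkg, hone'] at this
    simpa [localize] using this
  have hne : ∀ z : Ω, localize z g ≠ 0 := fun z h0 => by
    obtain ⟨C, hC⟩ := hker z
    obtain ⟨k, hk, hkg, -⟩ := hC.self_of_nhds
    have := hbound z k hk hkg
    rw [h0] at this
    norm_num at this
  have hli : ∀ z : Ω, LinearIndependent ℂ fun _ : Unit => localize z g :=
    fun z => linearIndependent_unique_iff.2 (hne z)
  refine ⟨⟨()⟩, ?_, hli, fun z => ?_, fun z₀ => ?_, fun f => ⟨fun h => ?_, fun h z => ?_⟩⟩
  · rwa [Set.range_const]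
  · have h1 : Dense (localize z '' (Submodule.span (FunAlg Ω) {g} : Set N)) :=
      (denseRange_localize z).dense_image (localizeL z : N →L[ℂ] _).continuous hgen
    refine h1.mono ?_
    rintro _ ⟨x, hx, rfl⟩
    obtain ⟨φ, rfl⟩ := Submodule.mem_span_singleton.1 hx
    rw [localize_smul]
    exact Submodule.smul_mem _ _ (Submodule.subset_span ⟨(), rfl⟩)
  · obtain ⟨C, hC⟩ := hker z₀
    refine ⟨C, hC.mono fun z hz v => ?_⟩
    obtain ⟨k, hk, hkg, hkC⟩ := hz
    obtain ⟨v, hv⟩ := v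
    obtain ⟨c, rfl⟩ : ∃ c : ℂ, c • localize z g = v := by
      rwa [Set.range_const, Submodule.mem_span_singleton] at hv
    have hfm : frameMap (fun _ : Unit => g) z (hli z) ⟨_, hv⟩ =
        c • lp.single 2 () (1 : ℂ) := by
      have hr : (hli z).repr ⟨_, hv⟩ = Finsupp.single () c := by
        apply LinearIndependent.repr_eq
        simp
      rw [frameMap, LinearMap.comp_apply, hr, Finsupp.linearCombination_single]
      congr!
    rw [hfm, norm_smul, lp.norm_single (by norm_num)]
    change ‖c‖ * ‖(1 : ℂ)‖ ≤ C * ‖c • localize z g‖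
    rw [norm_smul, norm_one]
    have h1 := (hbound z k hk hkg).trans (mul_le_mul_of_nonneg_right hkC (norm_nonneg _))
    nlinarith [norm_nonneg c]
  · refine hsep f fun z k hk => ?_
    have := inner_mul_inner_eq_zero hk (isEigenvectorAt_one z) (h z)
    rwa [hone, mul_one] at this
  · rw [h, ← localizeL_apply, map_zero]

end Eigenvectors

/-! ### Density of eigenvectors gives `C_{·0}` and (PS) -/

section QuasiFree

variable {m : ℕ} (Ω : Set (Fin m → ℂ)) (M : Type*)
  [NormedAddCommGroup M] [InnerProductSpace ℂ M] [Module (FunAlg Ω) M]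
  [IsScalarTower ℂ (FunAlg Ω) M] [ContinuousSMul (FunAlg Ω) M]

theorem exists_norm_mulOp_le : ∃ C : ℝ, ∀ φ : FunAlg Ω, ‖φ‖ ≤ 1 → ‖mulOp M φ‖ ≤ C := by
  have hc : Tendsto (fun p : FunAlg Ω × M => p.1 • p.2) (𝓝 (0, 0)) (𝓝 0) := by
    have := (continuous_smul (M := FunAlg Ω) (X := M)).tendsto (0, 0)
    rwa [smul_zero] at this
  obtain ⟨δ, hδ, H⟩ := Metric.eventually_nhds_iff.1 (hc (Metric.ball_mem_nhds 0 one_pos))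
  have key : ∀ (φ : FunAlg Ω) (f : M), ‖φ‖ < δ → ‖f‖ < δ → ‖φ • f‖ < 1 := fun φ f h1 h2 => by
    have : dist (φ, f) ((0 : FunAlg Ω), (0 : M)) < δ := by
      rw [Prod.dist_eq]; simp [h1, h2]
    simpa using H this
  have hc2 : ‖((δ / 2 : ℝ) : ℂ)‖ = δ / 2 := by
    rw [Complex.norm_real, Real.norm_of_nonneg (by positivity)]
  -- Scaling `φ` and a unit vector `f` by `δ / 2` each brings them into the neighbourhood given by
  -- joint continuity at the origin.
  refine ⟨(2 / δ) * (2 / δ), fun φ hφ => ?_⟩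
  refine ContinuousLinearMap.opNorm_le_of_unit_norm (𝕜 := ℂ) (by positivity) fun f hf => ?_
  have h := key (((δ / 2 : ℝ) : ℂ) • φ) (((δ / 2 : ℝ) : ℂ) • f)
    (by rw [norm_smul, hc2]; nlinarith) (by rw [norm_smul, hc2, hf]; linarith)
  rw [smul_assoc, smul_comm φ, norm_smul, norm_smul, hc2] at h
  change ‖φ • f‖ ≤ _
  rw [div_mul_div_comm, le_div_iff₀ (by positivity)]
  nlinarith

variable {Ω M} [CompleteSpace M]

theorem IsEigenvectorAt.adjoint_mulOp {z : Ω} {h : M} (hh : IsEigenvectorAt z h) (φ : FunAlg Ω) :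
    ContinuousLinearMap.adjoint (mulOp M φ) h = (starRingEnd ℂ) (φ z) • h := by
  refine ext_inner_right ℂ fun f => ?_
  rw [ContinuousLinearMap.adjoint_inner_left, inner_smul_left, Complex.conj_conj]
  exact hh φ f

/-- Convergence is immediate on eigenvectors; the uniform bound on `M_φ` over the unit ball carries
it to the closure of their span. -/
theorem classC0_of_dense_span_eigenvectors
    (hM : Dense (Submodule.span ℂ {h : M | ∃ z : Ω, IsEigenvectorAt z h} : Set M)) :
    ClassC0 Ω M := by
  intro φ hφ hφz f
  obtain ⟨C, hC⟩ := exists_norm_mulOp_le Ω M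
  have hC0 : 0 ≤ C := (norm_nonneg _).trans (hC _ (hφ 0))
  have hspan : ∀ h ∈ Submodule.span ℂ {h : M | ∃ z : Ω, IsEigenvectorAt z h},
      Tendsto (fun n => ContinuousLinearMap.adjoint (mulOp M (φ n)) h) atTop (𝓝 0) := by
    intro h hh
    induction hh using Submodule.span_induction with
    | mem h hh =>
      obtain ⟨z, hz⟩ := hh
      simp only [hz.adjoint_mulOp]
      have := ((Complex.continuous_conj.tendsto _).comp (hφz z)).smul_const h
      simpa using this
    | zero => simp
    | add x y _ _ hx hy => simpa using hx.add hy
    | smul c x _ hx => simpa using hx.const_smul c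
  rw [Metric.tendsto_atTop]
  intro ε hε
  obtain ⟨h, hh, hfh⟩ := Metric.dense_iff.1 hM f (ε / (2 * (C + 1))) (by positivity)
  obtain ⟨n₀, hn₀⟩ := Metric.tendsto_atTop.1 (hspan h hfh) (ε / 2) (by positivity)
  refine ⟨n₀, fun n hn => ?_⟩
  have h1 := hn₀ n hn
  rw [dist_zero_right] at h1 ⊢
  rw [Metric.mem_ball, dist_comm, dist_eq_norm, lt_div_iff₀ (by positivity)] at hh
  set A := ContinuousLinearMap.adjoint (mulOp M (φ n))
  have hA : ‖A‖ ≤ C := by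
    rw [LinearIsometryEquiv.norm_map]
    exact hC _ (hφ n)
  have h2 : ‖A (f - h)‖ ≤ C * ‖f - h‖ := A.le_of_opNorm_le hA _
  have h3 : A f = A (f - h) + A h := by rw [← map_add, sub_add_cancel]
  rw [h3]
  refine (norm_add_le _ _).trans_lt ?_
  nlinarith [norm_nonneg (f - h)]

theorem IsEigenvectorAt.isGenEigenvector {z : Ω} {h : M} (hh : IsEigenvectorAt z h) :
    IsGenEigenvector Ω h := by
  refine ⟨z, 1, le_rfl, fun φ => ?_⟩
  rw [pow_one]
  refine ext_inner_right ℂ fun f => ?_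
  rw [ContinuousLinearMap.adjoint_inner_left, inner_zero_left]
  change inner ℂ h (φ • f - φ z • f) = 0
  rw [inner_sub_right, hh, inner_smul_right, sub_self]

theorem classPS_of_dense_span_eigenvectors
    (hM : Dense (Submodule.span ℂ {h : M | ∃ z : Ω, IsEigenvectorAt z h} : Set M)) :
    ClassPS Ω M :=
  by
  refine hM.mono (Submodule.span_mono ?_)
  rintro h ⟨z, hz⟩
  exact hz.isGenEigenvector

end QuasiFree

/-! ### Heredity of the three classes -/

section Submodules

variable {m : ℕ} {Ω : Set (Fin m → ℂ)} {M : Type*}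
  [NormedAddCommGroup M] [InnerProductSpace ℂ M] [Module (FunAlg Ω) M]
  [IsScalarTower ℂ (FunAlg Ω) M]

/-- The inclusion of a submodule of a Hilbert module as a linear isometry. -/
def submoduleInclusion (M₀ : Submodule (FunAlg Ω) M) : M₀ →ₗᵢ[ℂ] M where
  toFun x := x
  map_add' _ _ := rfl
  map_smul' _ _ := rfl
  norm_map' _ := rfl

/-- The inclusion tensored with the identity of `R` maps balancing relations to balancing relations,
so an equality of tensors over `M₀` persists over `M`. -/
theorem IsSmooth.submodule {R : Type*} [NormedAddCommGroup R] [InnerProductSpace ℂ R]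
    [Module (FunAlg Ω) R] {g : R} (h : IsSmooth Ω M g) (M₀ : Submodule (FunAlg Ω) M) :
    IsSmooth Ω M₀ g := by
  set T : UniformSpace.Completion (M₀ ⊗[ℂ] R) →L[ℂ] UniformSpace.Completion (M ⊗[ℂ] R) :=
    ((submoduleInclusion M₀).rTensor R).toContinuousLinearMap.completion
  have hT : ∀ (f : M₀) (r : R), T ((f ⊗ₜ[ℂ] r : M₀ ⊗[ℂ] R) : UniformSpace.Completion _) =
      (((f : M) ⊗ₜ[ℂ] r : M ⊗[ℂ] R) : UniformSpace.Completion _) := fun f r => by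
    rw [ContinuousLinearMap.completion_apply_coe]
    rfl
  have hle : balancing Ω M₀ R ≤ (balancing Ω M R).comap T.toLinearMap := by
    refine Submodule.topologicalClosure_minimal _ ?_
      ((Submodule.isClosed_topologicalClosure _).preimage T.continuous)
    rw [Submodule.span_le]
    rintro _ ⟨φ, f, r, rfl⟩
    refine Submodule.le_topologicalClosure _ (Submodule.subset_span ⟨φ, f, r, ?_⟩)
    change T _ = _
    rw [UniformSpace.Completion.coe_sub, map_sub, hT, hT, UniformSpace.Completion.coe_sub]
    rfl
  intro f₁ f₂ h12
  refine Subtype.ext (h ?_)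
  have h1 := hle ((Submodule.Quotient.eq _).1 h12)
  rw [Submodule.mem_comap] at h1
  change T _ ∈ _ at h1
  rw [map_sub, hT, hT] at h1
  exact (Submodule.Quotient.eq _).2 h1

theorem ClassSM.submodule (h : ClassSM Ω M) (M₀ : Submodule (FunAlg Ω) M) : ClassSM Ω M₀ := by
  obtain ⟨R, i₁, i₂, i₃, i₄, i₅, i₆, g, hg, hs⟩ := h
  exact ⟨R, i₁, i₂, i₃, i₄, i₅, i₆, g, hg, hs.submodule M₀⟩

variable [CompleteSpace M] (M₀ : Submodule (FunAlg Ω) M) [CompleteSpace M₀]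

/-- The orthogonal projection onto a submodule, as the adjoint of the inclusion. -/
def submoduleProjection : M →L[ℂ] M₀ :=
  ContinuousLinearMap.adjoint (submoduleInclusion M₀).toContinuousLinearMap

theorem inner_submoduleProjection (h : M) (x : M₀) :
    inner ℂ (submoduleProjection M₀ h) x = inner ℂ h (x : M) :=
  ContinuousLinearMap.adjoint_inner_left _ _ _

theorem submoduleProjection_coe (x : M₀) : submoduleProjection M₀ (x : M) = x :=
  ext_inner_right ℂ fun _ => inner_submoduleProjection M₀ _ _

variable [ContinuousSMul (FunAlg Ω) M]

theorem adjoint_mulOp_submodule (φ : FunAlg Ω) (x : M₀) :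
    ContinuousLinearMap.adjoint (mulOp M₀ φ) x =
      submoduleProjection M₀ (ContinuousLinearMap.adjoint (mulOp M φ) (x : M)) := by
  refine ext_inner_right ℂ fun y => ?_
  rw [inner_submoduleProjection, ContinuousLinearMap.adjoint_inner_left,
    ContinuousLinearMap.adjoint_inner_left]
  rfl

theorem ClassC0.submodule (h : ClassC0 Ω M) : ClassC0 Ω M₀ := by
  intro φ hφ hφz f
  simp only [adjoint_mulOp_submodule]
  have := ((submoduleProjection M₀).continuous.tendsto 0).comp (h φ hφ hφz (f : M))
  rwa [map_zero] at this

theorem IsGenEigenvector.submoduleProjection {h : M} (hh : IsGenEigenvector Ω h) :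
    IsGenEigenvector Ω (submoduleProjection M₀ h) := by
  obtain ⟨z, n, hn, H⟩ := hh
  refine ⟨z, n, hn, fun φ => ?_⟩
  -- The inclusion intertwines the two multiplications, so its adjoint intertwines their adjoints.
  -- The vector `k` must range over all of `M`, because `M₀` need not be invariant under the
  -- adjoints.
  have key : ∀ (n : ℕ) (k : M),
      (ContinuousLinearMap.adjoint (mulOp M₀ φ - φ z • ContinuousLinearMap.id ℂ M₀) ^ n)
        (_root_.submoduleProjection M₀ k) = _root_.submoduleProjection M₀
      ((ContinuousLinearMap.adjoint (mulOp M φ - φ z • ContinuousLinearMap.id ℂ M) ^ n) k) := by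
    intro n
    induction n with
    | zero => intro k; rfl
    | succ n ih =>
      intro k
      rw [pow_succ, pow_succ, mul_apply_eq_comp, mul_apply_eq_comp, ← ih]
      congr 1
      refine ext_inner_right ℂ fun y => ?_
      rw [ContinuousLinearMap.adjoint_inner_left, inner_submoduleProjection,
        inner_submoduleProjection, ContinuousLinearMap.adjoint_inner_left]
      rfl
  rw [key, H, map_zero]

theorem ClassPS.submodule (h : ClassPS Ω M) : ClassPS Ω M₀ := by
  have hs : Function.Surjective (submoduleProjection M₀) := fun x =>
    ⟨x, submoduleProjection_coe M₀ x⟩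
  refine (hs.denseRange.dense_image (submoduleProjection M₀).continuous h).mono ?_
  rintro _ ⟨x, hx, rfl⟩
  change submoduleProjection M₀ x ∈ Submodule.span ℂ {h : M₀ | IsGenEigenvector Ω h}
  induction hx using Submodule.span_induction with
  | mem h hh => exact Submodule.subset_span (hh.submoduleProjection M₀)
  | zero => rw [map_zero]; exact zero_mem _
  | add x y _ _ hx hy => rw [map_add]; exact add_mem hx hy
  | smul c x _ hx => rw [map_smul]; exact Submodule.smul_mem _ c hx

end Submodules

/-! ### Mean value property on polydiscs -/

section MeanValue

open MeasureTheory Metric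

/-- Rotating every coordinate by `a` preserves Lebesgue measure and the sup norm. -/
theorem setIntegral_closedBall_smul_unit {m : ℕ} {F : (Fin m → ℂ) → ℂ} (r : ℝ) (a : Circle) :
    ∫ w in closedBall (0 : Fin m → ℂ) r, F ((a : ℂ) • w) =
      ∫ w in closedBall (0 : Fin m → ℂ) r, F w := by
  have hmp : MeasurePreserving (fun w : Fin m → ℂ => (a : ℂ) • w) volume volume :=
    volume_preserving_pi fun _ => (rotation a).measurePreserving
  have hemb : MeasurableEmbedding (fun w : Fin m → ℂ => (a : ℂ) • w) :=
    measurableEmbedding_const_smul₀ a.coe_ne_zero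
  rw [← hmp.setIntegral_preimage_emb hemb F]
  congr 2
  ext w
  have ha : ‖(a : ℂ)‖ = 1 := Circle.norm_coe a
  simp [norm_smul (a : ℂ) w, ha]

/-- The mean value property of holomorphic functions on polydiscs. -/
theorem setIntegral_closedBall_of_differentiableOn {m : ℕ} {U : Set (Fin m → ℂ)}
    {F : (Fin m → ℂ) → ℂ} (hF : DifferentiableOn ℂ F U) {z : Fin m → ℂ} {r : ℝ}
    (hr : closedBall z r ⊆ U) :
    ∫ w in closedBall z r, F w = volume.real (closedBall z r) • F z := by
  set B := closedBall (0 : Fin m → ℂ) r with hB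
  have hshift : ∫ w in closedBall z r, F w = ∫ w in B, F (z + w) := by
    rw [← (measurePreserving_add_left volume z).setIntegral_preimage_emb
      (measurableEmbedding_addLeft z)]
    simp [hB]
  have hvol : volume.real (closedBall z r) = volume.real B := by
    simp only [Measure.real, hB, Measure.addHaar_closedBall_center]
  have hmem : ∀ (ζ : ℂ), ‖ζ‖ ≤ 1 → ∀ w ∈ B, z + ζ • w ∈ U := fun ζ hζ w hw => by
    refine hr ?_
    rw [hB, mem_closedBall_zero_iff] at hw
    rw [mem_closedBall, dist_eq_norm, add_sub_cancel_left, norm_smul]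
    nlinarith [norm_nonneg w, norm_nonneg ζ]
  -- One-variable mean value property on the disc `ζ ↦ z + ζ w`.
  have havg : ∀ w ∈ B, ∫ θ in (0)..(2 * Real.pi), F (z + circleMap 0 1 θ • w) =
      (2 * Real.pi) • F z := fun w hw => by
    have hd : DifferentiableOn ℂ (fun ζ : ℂ => F (z + ζ • w)) (closedBall 0 1) :=
      hF.comp (by fun_prop) fun ζ hζ => hmem ζ (mem_closedBall_zero_iff.1 hζ) w hw
    have h1 : DiffContOnCl ℂ (fun ζ : ℂ => F (z + ζ • w)) (ball 0 |1|) := by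
      rw [abs_one]
      exact hd.diffContOnCl_ball subset_rfl
    have h2 := h1.circleAverage
    rw [Real.circleAverage, zero_smul, add_zero] at h2
    rw [← h2, smul_smul, mul_inv_cancel₀ (by positivity), one_smul]
  have hrot : ∀ θ : ℝ, ∫ w in B, F (z + circleMap 0 1 θ • w) = ∫ w in B, F (z + w) := fun θ => by
    have := setIntegral_closedBall_smul_unit (F := fun w => F (z + w)) r (Circle.exp θ)
    simpa [circleMap] using this
  have hcont : ContinuousOn (fun p : (Fin m → ℂ) × ℝ => F (z + circleMap 0 1 p.2 • p.1))
      (B ×ˢ Set.Icc 0 (2 * Real.pi)) := by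
    refine hF.continuousOn.comp ?_ fun p hp => hmem _ (by simp) _ hp.1
    have : Continuous (circleMap 0 1) := continuous_circleMap 0 1
    fun_prop
  have hint : IntegrableOn (fun p : (Fin m → ℂ) × ℝ => F (z + circleMap 0 1 p.2 • p.1))
      (B ×ˢ Set.Icc 0 (2 * Real.pi)) (volume.prod volume) :=
    hcont.integrableOn_compact ((isCompact_closedBall _ _).prod isCompact_Icc)
  have hint' : Integrable (Function.uncurry fun (w : Fin m → ℂ) (θ : ℝ) =>
      F (z + circleMap 0 1 θ • w))
      ((volume.restrict B).prod (volume.restrict (Set.Ioc 0 (2 * Real.pi)))) := by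
    rw [Measure.prod_restrict]
    exact hint.mono_set (Set.prod_mono subset_rfl Set.Ioc_subset_Icc_self)
  -- Integrating first in `θ` produces `F z`; integrating first in `w` produces, by rotation
  -- invariance, an integral independent of `θ`.
  have hswap := integral_integral_swap hint'
  have hpi : (0 : ℝ) ≤ 2 * Real.pi := by positivity
  simp only [← intervalIntegral.integral_of_le hpi] at hswap
  rw [setIntegral_congr_fun measurableSet_closedBall havg] at hswap
  simp only [hrot, setIntegral_const, intervalIntegral.integral_const, sub_zero] at hswap
  rw [hshift, hvol]
  rw [smul_comm] at hswap
  exact (smul_right_injective ℂ (by positivity : 2 * Real.pi ≠ 0) hswap).symm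

end MeanValue

/-! ### `L²(Ω)` as a module over `𝒜(Ω)` -/

section Bergman

open MeasureTheory Metric

variable {m : ℕ} (Ω : Set (Fin m → ℂ))

/-- The square integrable functions on `Ω`, with respect to Lebesgue measure. -/
def SquareIntegrable : Type :=
  Lp ℂ 2 (Measure.comap (Subtype.val : Ω → (Fin m → ℂ)) volume)

namespace SquareIntegrable

instance : NormedAddCommGroup (SquareIntegrable Ω) :=
  inferInstanceAs (NormedAddCommGroup (Lp ℂ 2 _))

instance : InnerProductSpace ℂ (SquareIntegrable Ω) :=
  inferInstanceAs (InnerProductSpace ℂ (Lp ℂ 2 _))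

instance : CompleteSpace (SquareIntegrable Ω) :=
  inferInstanceAs (CompleteSpace (Lp ℂ 2 _))

variable {Ω}

/-- A representative of the class of a square integrable function. -/
def toFun (f : SquareIntegrable Ω) : Ω → ℂ :=
  ((show Lp ℂ 2 (Measure.comap (Subtype.val : Ω → (Fin m → ℂ)) volume) from f : _) : Ω → ℂ)

theorem norm_toBCF_apply_le (φ : FunAlg Ω) (x : Ω) : ‖φ x‖ ≤ ‖φ‖ :=
  (FunAlg.toBCF φ).norm_coe_le_norm x

theorem memLp_mul (φ : FunAlg Ω) (f : SquareIntegrable Ω) :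
    MemLp (fun x => φ x * toFun f x) 2 (Measure.comap (Subtype.val : Ω → (Fin m → ℂ)) volume) :=
  (Lp.memLp f).of_le_mul
    ((FunAlg.toBCF φ).continuous.aestronglyMeasurable.mul (Lp.aestronglyMeasurable f))
    (c := ‖φ‖) (Eventually.of_forall fun x => by
      rw [norm_mul]
      exact mul_le_mul_of_nonneg_right (norm_toBCF_apply_le φ x) (norm_nonneg _))

instance : SMul (FunAlg Ω) (SquareIntegrable Ω) where
  smul φ f := (memLp_mul φ f).toLp _

theorem toFun_smul (φ : FunAlg Ω) (f : SquareIntegrable Ω) :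
    toFun (φ • f) =ᵐ[Measure.comap (Subtype.val : Ω → (Fin m → ℂ)) volume]
      fun x => φ x * toFun f x :=
  (memLp_mul φ f).coeFn_toLp

theorem toFun_add (f g : SquareIntegrable Ω) :
    toFun (f + g) =ᵐ[Measure.comap (Subtype.val : Ω → (Fin m → ℂ)) volume]
      fun x => toFun f x + toFun g x :=
  Lp.coeFn_add _ _

theorem toFun_const_smul (c : ℂ) (f : SquareIntegrable Ω) :
    toFun (c • f) =ᵐ[Measure.comap (Subtype.val : Ω → (Fin m → ℂ)) volume]
      fun x => c * toFun f x :=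
  Lp.coeFn_smul _ _

theorem toFun_zero :
    toFun (0 : SquareIntegrable Ω) =ᵐ[Measure.comap (Subtype.val : Ω → (Fin m → ℂ)) volume]
      fun _ => 0 :=
  Lp.coeFn_zero _ _ _

theorem ext {f g : SquareIntegrable Ω}
    (h : toFun f =ᵐ[Measure.comap (Subtype.val : Ω → (Fin m → ℂ)) volume] toFun g) : f = g :=
  Lp.ext h

instance : Module (FunAlg Ω) (SquareIntegrable Ω) where
  one_smul f := ext (by
    filter_upwards [toFun_smul 1 f] with x hx
    exact hx.trans (one_mul _))
  mul_smul φ ψ f := ext (by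
    filter_upwards [toFun_smul (φ * ψ) f, toFun_smul φ (ψ • f), toFun_smul ψ f] with x h1 h2 h3
    rw [h1, h2, h3]
    exact mul_assoc (φ x) (ψ x) _)
  smul_zero φ := ext (by
    filter_upwards [toFun_smul φ (0 : SquareIntegrable Ω), toFun_zero (Ω := Ω)] with x h1 h2
    rw [h1, h2, mul_zero])
  smul_add φ f g := ext (by
    filter_upwards [toFun_smul φ (f + g), toFun_smul φ f, toFun_smul φ g, toFun_add f g,
      toFun_add (φ • f) (φ • g)] with x h1 h2 h3 h4 h5
    rw [h1, h5, h2, h3, h4, mul_add])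
  add_smul φ ψ f := ext (by
    filter_upwards [toFun_smul (φ + ψ) f, toFun_smul φ f, toFun_smul ψ f,
      toFun_add (φ • f) (ψ • f)] with x h1 h2 h3 h4
    rw [h1, h4, h2, h3]
    exact add_mul (φ x) (ψ x) _)
  zero_smul f := ext (by
    filter_upwards [toFun_smul 0 f, toFun_zero (Ω := Ω)] with x h1 h2
    rw [h1, h2]
    exact zero_mul _)

instance : IsScalarTower ℂ (FunAlg Ω) (SquareIntegrable Ω) where
  smul_assoc c φ f := ext (by
    filter_upwards [toFun_smul (c • φ) f, toFun_const_smul c (φ • f), toFun_smul φ f]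
      with x h1 h2 h3
    rw [h1, h2, h3]
    exact mul_assoc c (φ x) _)

instance : IsBoundedSMul (FunAlg Ω) (SquareIntegrable Ω) :=
  .of_norm_smul_le fun φ f => Lp.norm_le_mul_norm_of_ae_le_mul (f := φ • f) (g := f) (by
    filter_upwards [toFun_smul φ f] with x hx
    change ‖toFun (φ • f) x‖ ≤ ‖φ‖ * ‖toFun f x‖
    rw [hx, norm_mul]
    exact mul_le_mul_of_nonneg_right (norm_toBCF_apply_le φ x) (norm_nonneg _))

end SquareIntegrable

end Bergman

/-! ### The Bergman type module and class (SM) -/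

section BergmanModule

open MeasureTheory Metric

variable {m : ℕ} {Ω : Set (Fin m → ℂ)}

/-- Both sides are continuous in the sup norm, as the polydisc has finite measure, so the mean value
property extends from `holoNhds Ω` to its closure. -/
theorem FunAlg.setIntegral_closedBall (hΩ : IsOpen Ω) (φ : FunAlg Ω) {z : Ω} {r : ℝ}
    (hr : closedBall (z : Fin m → ℂ) r ⊆ Ω) :
    ∫ x in Subtype.val ⁻¹' closedBall (z : Fin m → ℂ) r, φ x
        ∂Measure.comap (Subtype.val : Ω → (Fin m → ℂ)) volume =
      volume.real (closedBall (z : Fin m → ℂ) r) • φ z := by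
  set B := closedBall (z : Fin m → ℂ) r
  have hemb := MeasurableEmbedding.subtype_coe hΩ.measurableSet
  set ν := (Measure.comap (Subtype.val : Ω → (Fin m → ℂ)) volume).restrict (Subtype.val ⁻¹' B)
    with hν
  have hfin : IsFiniteMeasure ν := by
    refine ⟨?_⟩
    rw [Measure.restrict_apply_univ, hemb.comap_apply]
    exact (measure_mono (Set.image_preimage_subset _ _)).trans_lt measure_closedBall_lt_top
  have hcont : Continuous fun ψ : Ω →ᵇ ℂ => ∫ x, ψ x ∂ν := by
    refine (LipschitzWith.of_dist_le_mul (K := Real.toNNReal (ν.real Set.univ))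
      fun ψ₁ ψ₂ => ?_).continuous
    rw [dist_eq_norm, dist_eq_norm, ← integral_sub (ψ₁.integrable ν) (ψ₂.integrable ν),
      Real.coe_toNNReal _ measureReal_nonneg]
    exact (ψ₁ - ψ₂).norm_integral_le_mul_norm ν
  have hclosed : IsClosed {ψ : Ω →ᵇ ℂ | ∫ x, ψ x ∂ν = volume.real B • ψ z} :=
    isClosed_eq hcont ((continuous_eval_const (F := Ω →ᵇ ℂ) z).fun_const_smul _)
  refine closure_minimal ?_ hclosed φ.2
  rintro ψ ⟨U, -, hΩU, F, hF, hψ⟩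
  have hBU : B ⊆ U := hr.trans (subset_closure.trans hΩU)
  change ∫ x, ψ x ∂ν = volume.real B • ψ z
  simp only [hψ]
  rw [← setIntegral_closedBall_of_differentiableOn hF hBU, hν, hemb.restrict_comap,
    integral_subtype_comap hΩ.measurableSet, Measure.restrict_restrict hΩ.measurableSet,
    Subtype.image_preimage_coe, Set.inter_eq_right.2 hr, Set.inter_eq_right.2 hr]

theorem exists_constant_one (hΩ : IsOpen Ω) (hΩb : Bornology.IsBounded Ω) :
    ∃ e : SquareIntegrable Ω,
      e.toFun =ᵐ[Measure.comap (Subtype.val : Ω → (Fin m → ℂ)) volume] fun _ => 1 := by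
  have hfin : IsFiniteMeasure (Measure.comap (Subtype.val : Ω → (Fin m → ℂ)) volume) := by
    refine ⟨?_⟩
    rw [(MeasurableEmbedding.subtype_coe hΩ.measurableSet).comap_apply]
    exact (measure_mono (by simp)).trans_lt hΩb.measure_lt_top
  exact ⟨(memLp_const (1 : ℂ)).toLp _, (memLp_const (1 : ℂ)).coeFn_toLp⟩

theorem SquareIntegrable.toFun_smul_one {e : SquareIntegrable Ω}
    (he : e.toFun =ᵐ[Measure.comap (Subtype.val : Ω → (Fin m → ℂ)) volume] fun _ => 1)
    (φ : FunAlg Ω) :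
    toFun (φ • e) =ᵐ[Measure.comap (Subtype.val : Ω → (Fin m → ℂ)) volume] fun x => φ x := by
  filter_upwards [toFun_smul φ e, he] with x h1 h2
  rw [h1, h2, mul_one]

/-- The averaging functional over a polydisc of radius `r` in `Ω` evaluates the elements of
`𝒜(Ω)` at the centre, and its norm depends only on `r`. -/
theorem exists_inner_smul_one_eq (hΩ : IsOpen Ω) {e : SquareIntegrable Ω}
    (he : e.toFun =ᵐ[Measure.comap (Subtype.val : Ω → (Fin m → ℂ)) volume] fun _ => 1)
    {r : ℝ} (hr : 0 < r) :
    ∃ C : ℝ, ∀ z : Ω, closedBall (z : Fin m → ℂ) r ⊆ Ω →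
      ∃ k : SquareIntegrable Ω, ‖k‖ ≤ C ∧ ∀ φ : FunAlg Ω, inner ℂ k (φ • e) = φ z := by
  set V := volume.real (closedBall (0 : Fin m → ℂ) r) with hV
  have hV0 : 0 < V :=
    ENNReal.toReal_pos (measure_closedBall_pos _ _ hr).ne' measure_closedBall_lt_top.ne
  -- The kernel is `V⁻¹` times the indicator of the polydisc, and the indicator has `L²` norm the
  -- square root of `V`.
  refine ⟨V⁻¹ * V ^ (1 / (2 : ENNReal).toReal), fun z hz => ?_⟩
  set B := closedBall (z : Fin m → ℂ) r with hB
  have hVB : volume.real B = V := by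
    simp only [Measure.real, hV, hB, Measure.addHaar_closedBall_center]
  set μ := Measure.comap (Subtype.val : Ω → (Fin m → ℂ)) volume with hμ
  have hμB : μ (Subtype.val ⁻¹' B) = volume B := by
    rw [hμ, (MeasurableEmbedding.subtype_coe hΩ.measurableSet).comap_apply,
      Subtype.image_preimage_coe, Set.inter_eq_right.2 hz]
  have hμB' : μ.real (Subtype.val ⁻¹' B) = V := by rw [Measure.real, hμB, ← hVB, Measure.real]
  have hmeas : MeasurableSet ((Subtype.val : Ω → _) ⁻¹' B) :=
    measurable_subtype_coe measurableSet_closedBall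
  have hne : μ (Subtype.val ⁻¹' B) ≠ ⊤ := hμB.trans_ne measure_closedBall_lt_top.ne
  set i : SquareIntegrable Ω := indicatorConstLp 2 hmeas hne (1 : ℂ) with hi
  refine ⟨((V⁻¹ : ℝ) : ℂ) • i, ?_, fun φ => ?_⟩
  · have : ‖i‖ = V ^ (1 / (2 : ENNReal).toReal) := by
      refine (norm_indicatorConstLp (by norm_num) (by norm_num)).trans ?_
      rw [norm_one, one_mul, hμB']
    rw [norm_smul, Complex.norm_real, Real.norm_of_nonneg (by positivity), this]
  · have h1 : inner ℂ i (φ • e) = ∫ x in Subtype.val ⁻¹' B, (φ • e).toFun x ∂μ :=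
      L2.inner_indicatorConstLp_one hmeas hne _
    rw [inner_smul_left, h1, integral_congr_ae (ae_restrict_of_ae (e.toFun_smul_one he φ)),
      FunAlg.setIntegral_closedBall hΩ φ hz, hVB, Complex.conj_ofReal, Complex.real_smul,
      ← mul_assoc, ← Complex.ofReal_mul, inv_mul_cancel₀ hV0.ne', Complex.ofReal_one, one_mul]

/-- The Bergman type module: the closed submodule of `L²(Ω)` generated by `e`. -/
def generatedModule (e : SquareIntegrable Ω) : Submodule (FunAlg Ω) (SquareIntegrable Ω) :=
  (Submodule.span (FunAlg Ω) {e}).topologicalClosure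

instance (e : SquareIntegrable Ω) : CompleteSpace (generatedModule e) :=
  (Submodule.isClosed_topologicalClosure _).completeSpace_coe

/-- The generator of the module generated by `e`. -/
def moduleGenerator (e : SquareIntegrable Ω) : generatedModule e :=
  ⟨e, Submodule.le_topologicalClosure _ (Submodule.mem_span_singleton_self e)⟩

theorem dense_span_moduleGenerator (e : SquareIntegrable Ω) :
    Dense (Submodule.span (FunAlg Ω) {moduleGenerator e} : Set (generatedModule e)) := by
  intro x
  rw [closure_subtype]
  refine closure_mono ?_ x.2
  intro y hy
  obtain ⟨φ, rfl⟩ := Submodule.mem_span_singleton.1 hy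
  exact ⟨φ • moduleGenerator e, Submodule.smul_mem _ _ (Submodule.mem_span_singleton_self _), rfl⟩

/-- On the dense subspace of multiples `ψ g` this is multiplicativity of evaluation at `z`. -/
theorem isEigenvectorAt_of_inner_smul {R : Type*} [NormedAddCommGroup R] [InnerProductSpace ℂ R]
    [Module (FunAlg Ω) R] [ContinuousSMul (FunAlg Ω) R] {g : R}
    (hgen : Dense (Submodule.span (FunAlg Ω) {g} : Set R)) {z : Ω} {k : R}
    (hk : ∀ φ : FunAlg Ω, inner ℂ k (φ • g) = φ z) : IsEigenvectorAt z k := by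
  intro φ
  refine fun f => congrFun (Continuous.ext_on (f := fun f => inner ℂ k (φ • f))
    (g := fun f => φ z * inner ℂ k f) hgen ?_ ?_ ?_) f
  · exact continuous_const.inner (continuous_const_smul φ)
  · exact continuous_const.mul (continuous_const.inner continuous_id)
  · intro x hx
    obtain ⟨ψ, rfl⟩ := Submodule.mem_span_singleton.1 hx
    change inner ℂ k (φ • ψ • g) = φ z * inner ℂ k (ψ • g)
    rw [smul_smul, hk, hk]
    rfl

theorem exists_kernel (hΩ : IsOpen Ω) {e : SquareIntegrable Ω}
    (he : e.toFun =ᵐ[Measure.comap (Subtype.val : Ω → (Fin m → ℂ)) volume] fun _ => 1) (z₀ : Ω) :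
    ∃ C : ℝ, ∀ᶠ z in 𝓝 z₀, ∃ k : generatedModule e, ‖k‖ ≤ C ∧
      ∀ φ : FunAlg Ω, inner ℂ k (φ • moduleGenerator e) = φ z := by
  obtain ⟨r, hr, hrΩ⟩ := Metric.isOpen_iff.1 hΩ z₀ z₀.2
  obtain ⟨C, hC⟩ := exists_inner_smul_one_eq hΩ he (half_pos hr)
  refine ⟨‖submoduleProjection (generatedModule e)‖ * C, ?_⟩
  -- Polydiscs of the fixed radius `r / 2` about these centres stay in `Ω`, so one constant serves
  -- them all.
  filter_upwards [Metric.ball_mem_nhds z₀ (half_pos hr)] with z hz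
  obtain ⟨k, hkC, hk⟩ := hC z (fun x hx => hrΩ (by
    have h1 : dist (z : Fin m → ℂ) z₀ < r / 2 := hz
    have h2 : dist x z ≤ r / 2 := hx
    exact mem_ball.2 ((dist_triangle x z z₀).trans_lt (by linarith))))
  refine ⟨submoduleProjection _ k, ?_, fun φ => ?_⟩
  · exact ((submoduleProjection (generatedModule e)).le_opNorm k).trans
      (mul_le_mul_of_nonneg_left hkC (norm_nonneg _))
  · rw [inner_submoduleProjection]
    exact hk φ

theorem isQuasiFree_moduleGenerator (hΩ : IsOpen Ω) {e : SquareIntegrable Ω}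
    (he : e.toFun =ᵐ[Measure.comap (Subtype.val : Ω → (Fin m → ℂ)) volume] fun _ => 1) :
    IsQuasiFree (Ω := Ω) (fun _ : Unit => moduleGenerator e) := by
  have hgen := dense_span_moduleGenerator e
  refine isQuasiFree_of_kernels hgen (fun z₀ => ?_) fun f hf => ?_
  · obtain ⟨C, hC⟩ := exists_kernel hΩ he z₀
    refine ⟨C, hC.mono fun z ⟨k, hkC, hk⟩ => ⟨k, isEigenvectorAt_of_inner_smul hgen hk, ?_, hkC⟩⟩
    rw [← one_smul (FunAlg Ω) (moduleGenerator e), hk]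
    rfl
  -- Write `f` as an `L²` limit of `φ n • e`. Pairing with kernels shows `φ n z → 0` at every `z`,
  -- while a subsequence converges to `f` almost everywhere; hence `f = 0`.
  · obtain ⟨u, hu, hlim⟩ := mem_closure_iff_seq_limit.1 (hgen f)
    choose φ hφ using fun n => Submodule.mem_span_singleton.1 (hu n)
    have hlim' : Tendsto (fun n => φ n • e) atTop (𝓝 (f : SquareIntegrable Ω)) := by
      have := (continuous_subtype_val.tendsto f).comp hlim
      refine this.congr fun n => ?_
      rw [Function.comp_apply, ← hφ]
      rfl
    obtain ⟨ns, hns, hae⟩ := (tendstoInMeasure_of_tendsto_Lp hlim').exists_seq_tendsto_ae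
    have hpt : ∀ z : Ω, Tendsto (fun n => φ n z) atTop (𝓝 0) := fun z => by
      obtain ⟨C, hC⟩ := exists_kernel hΩ he z
      obtain ⟨k, -, hk⟩ := hC.self_of_nhds
      have h1 : Tendsto (fun n => inner ℂ k (u n)) atTop (𝓝 (inner ℂ k f)) :=
        tendsto_const_nhds.inner hlim
      rw [hf z k (isEigenvectorAt_of_inner_smul hgen hk)] at h1
      refine h1.congr fun n => ?_
      rw [← hφ, hk]
    refine Subtype.ext (SquareIntegrable.ext ?_)
    have hall := ae_all_iff.2 fun n => e.toFun_smul_one he (φ n)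
    filter_upwards [hae, hall, SquareIntegrable.toFun_zero (Ω := Ω)] with x h1 h2 h3
    refine Eq.trans ?_ h3.symm
    refine tendsto_nhds_unique h1 (((hpt x).comp hns.tendsto_atTop).congr fun n => ?_)
    exact (h2 (ns n)).symm

theorem classSM_of_dense_span_eigenvectors (hΩ : IsOpen Ω) (hΩb : Bornology.IsBounded Ω)
    {M : Type*} [NormedAddCommGroup M] [InnerProductSpace ℂ M] [CompleteSpace M]
    [Module (FunAlg Ω) M] [IsScalarTower ℂ (FunAlg Ω) M] [ContinuousSMul (FunAlg Ω) M]
    (hM : Dense (Submodule.span ℂ {h : M | ∃ z : Ω, IsEigenvectorAt z h} : Set M)) :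
    ClassSM Ω M := by
  obtain ⟨e, he⟩ := exists_constant_one hΩ hΩb
  refine ⟨generatedModule e, inferInstance, inferInstance, inferInstance, inferInstance,
    inferInstance, inferInstance, moduleGenerator e, isQuasiFree_moduleGenerator hΩ he,
    isSmooth_of_dense_span_eigenvectors hM fun z => ?_⟩
  obtain ⟨C, hC⟩ := exists_kernel hΩ he z
  obtain ⟨k, -, hk⟩ := hC.self_of_nhds
  refine ⟨k, isEigenvectorAt_of_inner_smul (dense_span_moduleGenerator e) hk, ?_⟩
  rw [← one_smul (FunAlg Ω) (moduleGenerator e), hk]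
  exact one_ne_zero

end BergmanModule

end

theorem mainTheorem8 {m : ℕ} (Ω : Set (Fin m → ℂ)) (hΩo : IsOpen Ω) (hΩc : IsConnected Ω)
    (hΩb : Bornology.IsBounded Ω)
    (M : Type*) [NormedAddCommGroup M] [InnerProductSpace ℂ M] [CompleteSpace M]
    [Module (FunAlg Ω) M] [IsScalarTower ℂ (FunAlg Ω) M] [ContinuousSMul (FunAlg Ω) M]
    (M₀ : Submodule (FunAlg Ω) M) (hM₀ : IsClosed (M₀ : Set M)) :
    haveI : CompleteSpace M₀ := hM₀.completeSpace_coe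
    (ClassC0 Ω M → ClassC0 Ω M₀) ∧
    (ClassPS Ω M → ClassPS Ω M₀) ∧
    (ClassSM Ω M → ClassSM Ω M₀) ∧
    (∀ (ι : Type*) (f : ι → M), IsQuasiFree (Ω := Ω) f →
      ClassC0 Ω M₀ ∧ ClassPS Ω M₀ ∧ ClassSM Ω M₀) := by
  have : CompleteSpace M₀ := hM₀.completeSpace_coe
  refine ⟨fun h => h.submodule M₀, fun h => h.submodule M₀, fun h => h.submodule M₀,
    fun ι f hf => ?_⟩
  have hM := dense_span_eigenvectors fun g => (hf.separates g).1
  exact ⟨(classC0_of_dense_span_eigenvectors hM).submodule M₀,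
    (classPS_of_dense_span_eigenvectors hM).submodule M₀,
    (classSM_of_dense_span_eigenvectors hΩo hΩb hM).submodule M₀⟩
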